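/- Let $\mathcal M$ be the commutative monoid (written additively) presented by generators $x_0,y_0,z_0,a_1,x_1,y_1,z_1,a_2,x_2,y_2,z_2,\dots$ and relations $$x_0+y_0=x_0+z_0,\qquad y_l=y_{l+1}+a_{l+1},\qquad z_l=z_{l+1}+a_{l+1},\qquad x_l=x_{l+1}+y_{l+1}=x_{l+1}+z_{l+1}\qquad(l\ge 0),$$ and put $u:=x_0+y_0\in\mathcal M$. Let $\operatorname{ped}(\mathcal M)$ be the submonoid generated by the irreducible elements of $\mathcal M$, i.e. the elements $x\neq 0$ such that $a+b=x$ implies $a=0$ or $b=0$. Let $\mathcal M/\operatorname{ped}(\mathcal M)$ be the quotient of $\mathcal M$ by the congruence $x\equiv y \iff x+a=y+b$ for some $a,b\in\operatorname{ped}(\mathcal M)$. For a unital ring $R$, let $V(R)$ be the monoid of equivalence classes $[e]$ of idempotent square matrices $e$ of arbitrary finite size over $R$, where $e\sim f$ if and only if $e=vw$ and $f=wv$ for some rectangular matrices $v,w$ over $R$, with addition $[e]+[f]=\left[\begin{pmatrix} e&0\\0&f\end{pmatrix}\right]$. For an ideal $I$ of $R$, identify $V(I)$ with the submonoid of $V(R)$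 consisting of the classes of idempotent matrices with entries in $I$. A unital ring $R$ is an exchange ring if for each $a\in R$ there is an idempotent $e\in aR$ with $1-e\in(1-a)R$. Let $R$ be a unital exchange algebra over a field $K$ such that $\operatorname{soc}(R)\cong\bigoplus_{i=1}^{\infty}M_i(K)$ as (non-unital) $K$-algebras, and such that $\operatorname{soc}(R)$ is essential in $R$, where $\operatorname{soc}(R)$ is the sum of the minimal left ideals of $R$ (under these hypotheses $R$ is semiprime, so this is also the sum of the minimal right ideals) and essential means that it meets every nonzero ideal of $R$ nontrivially. Let $\tau\colon\mathcal M\to V(R)$ be a monoid homomorphism with $\tau(u)=[1_R]$ such that $\tau$ restricts to an isomorphism from $\operatorname{ped}(\mathcal M)$ onto $V(\operatorname{soc}(R))$, and such that the induced map $$\overline{\tau}\colon \mathcal M/\operatorname{ped}(\mathcal M)\longrightarrow V(R/\operatorname{soc}(R))$$ (induced by the composite of $\tau$ with the canonical map $V(R)\to V(R/\operatorname{soc}(R))$) is an isomorphism. Then $\tau$ is an isomorphism. -/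

import Mathlib

/-! ### Commutative monoids -/

namespace CMon

/-- An irreducible element of a conical commutative monoid: a nonzero element that is not
a sum of two nonzero elements. -/
def IsIrred {M : Type*} [AddCommMonoid M] (x : M) : Prop :=
  x ≠ 0 ∧ ∀ a b : M, a + b = x → a = 0 ∨ b = 0

/-- The pedestal: the submonoid generated by the irreducible elements. -/
def ped (M : Type*) [AddCommMonoid M] : AddSubmonoid M :=
  AddSubmonoid.closure {x : M | IsIrred x}

/-- The congruence `x ≡ y ↔ x + a = y + b for some a, b ∈ I`. -/
def quotCon {M : Type*} [AddCommMonoid M] (I : AddSubmonoid M) : AddCon M where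
  r x y := ∃ a ∈ I, ∃ b ∈ I, x + a = y + b
  iseqv :=
    { refl := fun _ => ⟨0, I.zero_mem, 0, I.zero_mem, rfl⟩
      symm := fun ⟨a, ha, b, hb, h⟩ => ⟨b, hb, a, ha, h.symm⟩
      trans := by
        rintro x y z ⟨a, ha, b, hb, h⟩ ⟨c, hc, d, hd, h'⟩
        refine ⟨a + c, I.add_mem ha hc, d + b, I.add_mem hd hb, ?_⟩
        rw [← add_assoc, h, add_right_comm, h', add_assoc] }
  add' := by
    rintro w x y z ⟨a, ha, b, hb, h⟩ ⟨c, hc, d, hd, h'⟩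
    refine ⟨a + c, I.add_mem ha hc, b + d, I.add_mem hb hd, ?_⟩
    rw [add_add_add_comm, h, h', add_add_add_comm]

/-- The quotient monoid `M / I`. -/
abbrev QuotMonoid (M : Type*) [AddCommMonoid M] (I : AddSubmonoid M) : Type _ :=
  (quotCon I).Quotient

/-- The canonical projection `M → M / I`. -/
def toQuot {M : Type*} [AddCommMonoid M] (I : AddSubmonoid M) : M →+ QuotMonoid M I :=
  (quotCon I).mk'

end CMon

/-! ### The monoid `𝓜` -/

namespace MonM

/-- The generators of `𝓜`. The generator `a l` stands for the one usually written `a_{l+1}`. -/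
inductive Gen : Type
  | x (l : ℕ) : Gen
  | y (l : ℕ) : Gen
  | z (l : ℕ) : Gen
  | a (l : ℕ) : Gen

/-- A generator, as an element of the free commutative monoid on the generators. -/
noncomputable def Gen.free (g : Gen) : Gen →₀ ℕ := Finsupp.single g 1

open Gen in
/-- The defining relations of `𝓜`. -/
inductive Rel : (Gen →₀ ℕ) → (Gen →₀ ℕ) → Prop
  | base : Rel ((x 0).free + (y 0).free) ((x 0).free + (z 0).free)
  | ya (l : ℕ) : Rel (y l).free ((y (l + 1)).free + (a l).free)
  | za (l : ℕ) : Rel (z l).free ((z (l + 1)).free + (a l).free)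
  | xy (l : ℕ) : Rel (x l).free ((x (l + 1)).free + (y (l + 1)).free)
  | xz (l : ℕ) : Rel (x l).free ((x (l + 1)).free + (z (l + 1)).free)

end MonM

/-- The commutative monoid `𝓜`, given by generators and relations. -/
abbrev MonM : Type := (addConGen MonM.Rel).Quotient

namespace MonM

/-- The class of a generator in `𝓜`. -/
noncomputable def of (g : Gen) : MonM := (addConGen Rel).mk' g.free

/-- The canonical order-unit `u = x₀ + y₀` of `𝓜`. -/
noncomputable def u : MonM := of (Gen.x 0) + of (Gen.y 0)

end MonM

/-! ### The V-monoid of a unital ring, in the idempotent picture -/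

/-- Equivalence of (idempotent) square matrices: `e = u v` and `f = v u` for some rectangular
matrices `u`, `v`. -/
def MatEquiv {R : Type*} [Ring R] {ι κ : Type*} [Fintype ι] [Fintype κ]
    (e : Matrix ι ι R) (f : Matrix κ κ R) : Prop :=
  ∃ (u : Matrix ι κ R) (v : Matrix κ ι R), u * v = e ∧ v * u = f

namespace MatEquiv

variable {R : Type*} [Ring R] {ι κ l ι' κ' : Type*} [Fintype ι] [Fintype κ] [Fintype l]
  [Fintype ι'] [Fintype κ']

theorem refl {e : Matrix ι ι R} (he : IsIdempotentElem e) : MatEquiv e e := ⟨e, e, he, he⟩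

theorem symm {e : Matrix ι ι R} {f : Matrix κ κ R} (h : MatEquiv e f) : MatEquiv f e := by
  obtain ⟨u, v, h1, h2⟩ := h
  exact ⟨v, u, h2, h1⟩

theorem trans {e : Matrix ι ι R} {f : Matrix κ κ R} {g : Matrix l l R}
    (he : IsIdempotentElem e) (hg : IsIdempotentElem g)
    (h : MatEquiv e f) (h' : MatEquiv f g) : MatEquiv e g := by
  obtain ⟨u, v, h1, h2⟩ := h
  obtain ⟨u', v', h3, h4⟩ := h'
  refine ⟨u * u', v' * v, ?_, ?_⟩
  · calc u * u' * (v' * v) = u * (u' * v') * v := by simp only [Matrix.mul_assoc]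
      _ = (u * v) * (u * v) := by rw [h3, ← h2]; simp only [Matrix.mul_assoc]
      _ = e := by rw [h1]; exact he
  · calc v' * v * (u * u') = v' * (v * u) * u' := by simp only [Matrix.mul_assoc]
      _ = (v' * u') * (v' * u') := by rw [h2, ← h3]; simp only [Matrix.mul_assoc]
      _ = g := by rw [h4]; exact hg

theorem reindex {e : Matrix ι ι R} (he : IsIdempotentElem e) (σ : ι ≃ κ) :
    MatEquiv e (Matrix.reindex σ σ e) := by
  refine ⟨e.submatrix id σ.symm, e.submatrix σ.symm id, ?_, ?_⟩
  · rw [Matrix.submatrix_mul_equiv, he.eq, Matrix.submatrix_id_id]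
  · have h := Matrix.submatrix_mul e e σ.symm (id : ι → ι) σ.symm Function.bijective_id
    rw [he.eq] at h
    rw [Matrix.reindex_apply, h]

theorem blocks {e : Matrix ι ι R} {f : Matrix κ κ R} {e' : Matrix ι' ι' R} {f' : Matrix κ' κ' R}
    (h : MatEquiv e e') (h' : MatEquiv f f') :
    MatEquiv (Matrix.fromBlocks e 0 0 f) (Matrix.fromBlocks e' 0 0 f') := by
  obtain ⟨u, v, h1, h2⟩ := h
  obtain ⟨u', v', h3, h4⟩ := h'
  exact ⟨Matrix.fromBlocks u 0 0 u', Matrix.fromBlocks v 0 0 v',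
    by simp [Matrix.fromBlocks_multiply, h1, h3], by simp [Matrix.fromBlocks_multiply, h2, h4]⟩

end MatEquiv

theorem isIdempotentElem_reindex {R : Type*} [Ring R] {ι κ : Type*} [Fintype ι] [Fintype κ]
    {e : Matrix ι ι R} (he : IsIdempotentElem e) (σ : ι ≃ κ) :
    IsIdempotentElem (Matrix.reindex σ σ e) := by
  unfold IsIdempotentElem
  rw [Matrix.reindex_apply, Matrix.submatrix_mul_equiv, he.eq]

theorem isIdempotentElem_blocks {R : Type*} [Ring R] {ι κ : Type*} [Fintype ι] [Fintype κ]
    {e : Matrix ι ι R} {f : Matrix κ κ R} (he : IsIdempotentElem e) (hf : IsIdempotentElem f) :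
    IsIdempotentElem (Matrix.fromBlocks e 0 0 f) := by
  unfold IsIdempotentElem
  simp [Matrix.fromBlocks_multiply, he.eq, hf.eq]

/-- A square idempotent matrix (of any finite size) over `R`. -/
structure IdemMat (R : Type*) [Ring R] where
  /-- The size of the matrix. -/
  size : ℕ
  /-- The matrix. -/
  mat : Matrix (Fin size) (Fin size) R
  idem : IsIdempotentElem mat

namespace IdemMat

variable {R : Type*} [Ring R]

/-- The block sum of two idempotent matrices. -/
def add (e f : IdemMat R) : IdemMat R where
  size := e.size + f.size
  mat := Matrix.reindex finSumFinEquiv finSumFinEquiv (Matrix.fromBlocks e.mat 0 0 f.mat)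
  idem := isIdempotentElem_reindex (isIdempotentElem_blocks e.idem f.idem) _

/-- The idempotent matrix of size zero. -/
def zero (R : Type*) [Ring R] : IdemMat R := ⟨0, 0, by simp [IsIdempotentElem]⟩

/-- An idempotent of `R`, as a matrix of size one. -/
def ofElem (p : R) (hp : IsIdempotentElem p) : IdemMat R where
  size := 1
  mat := Matrix.of fun _ _ => p
  idem := by
    ext i j
    simpa [Matrix.mul_apply] using hp.eq

/-- Applying a ring homomorphism entrywise. -/
def map {S : Type*} [Ring S] (φ : R →+* S) (e : IdemMat R) : IdemMat S where
  size := e.size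
  mat := e.mat.map φ
  idem := by
    unfold IsIdempotentElem
    rw [← Matrix.map_mul, e.idem.eq]

theorem add_equiv (e f : IdemMat R) :
    MatEquiv (Matrix.fromBlocks e.mat 0 0 f.mat) (e.add f).mat :=
  MatEquiv.reindex (isIdempotentElem_blocks e.idem f.idem) _

/-- Equivalence of idempotent matrices. -/
instance setoid (R : Type*) [Ring R] : Setoid (IdemMat R) where
  r e f := MatEquiv e.mat f.mat
  iseqv :=
    { refl := fun e => MatEquiv.refl e.idem
      symm := MatEquiv.symm
      trans := fun {e _ g} h h' => MatEquiv.trans e.idem g.idem h h' }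

theorem add_congr {e e' f f' : IdemMat R} (h : MatEquiv e.mat e'.mat)
    (h' : MatEquiv f.mat f'.mat) : MatEquiv (e.add f).mat (e'.add f').mat :=
  MatEquiv.trans (e.add f).idem (e'.add f').idem
    (MatEquiv.trans (e.add f).idem (isIdempotentElem_blocks e'.idem f'.idem)
      (add_equiv e f).symm (MatEquiv.blocks h h'))
    (add_equiv e' f')

theorem map_congr {S : Type*} [Ring S] (φ : R →+* S) {e f : IdemMat R}
    (h : MatEquiv e.mat f.mat) : MatEquiv (e.map φ).mat (f.map φ).mat := by
  obtain ⟨u, v, h1, h2⟩ := h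
  have h3 : u.map φ * v.map φ = e.mat.map φ := by rw [← Matrix.map_mul, h1]
  have h4 : v.map φ * u.map φ = f.mat.map φ := by rw [← Matrix.map_mul, h2]
  exact ⟨u.map φ, v.map φ, h3, h4⟩

theorem add_comm_equiv (e f : IdemMat R) : MatEquiv (e.add f).mat (f.add e).mat := by
  have hb := isIdempotentElem_blocks e.idem f.idem
  have hb' := isIdempotentElem_blocks f.idem e.idem
  have h := MatEquiv.reindex hb (Equiv.sumComm _ _)
  have h2 : Matrix.reindex (Equiv.sumComm _ _) (Equiv.sumComm _ _)
      (Matrix.fromBlocks e.mat 0 0 f.mat) = Matrix.fromBlocks f.mat 0 0 e.mat := by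
    ext i j
    rcases i with i | i <;> rcases j with j | j <;> rfl
  rw [h2] at h
  exact MatEquiv.trans (e.add f).idem (f.add e).idem
    (MatEquiv.trans (e.add f).idem hb' (add_equiv e f).symm h) (add_equiv f e)

theorem zero_add_equiv (e : IdemMat R) : MatEquiv ((zero R).add e).mat e.mat := by
  have hb := isIdempotentElem_blocks (zero R).idem e.idem
  have : IsEmpty (Fin (zero R).size) := Fin.isEmpty
  have h := MatEquiv.reindex hb (Equiv.emptySum (Fin (zero R).size) (Fin e.size))
  have h2 : Matrix.reindex (Equiv.emptySum (Fin (zero R).size) (Fin e.size)) (Equiv.emptySum _ _)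
      (Matrix.fromBlocks (zero R).mat 0 0 e.mat) = e.mat := by
    ext i j
    rfl
  rw [h2] at h
  exact MatEquiv.trans ((zero R).add e).idem e.idem (add_equiv _ e).symm h

theorem add_assoc_equiv (e f g : IdemMat R) :
    MatEquiv ((e.add f).add g).mat (e.add (f.add g)).mat := by
  have hl := isIdempotentElem_blocks (isIdempotentElem_blocks e.idem f.idem) g.idem
  have hr := isIdempotentElem_blocks e.idem (isIdempotentElem_blocks f.idem g.idem)
  have h := MatEquiv.reindex hl (Equiv.sumAssoc _ _ _)
  have h2 : Matrix.reindex (Equiv.sumAssoc _ _ _) (Equiv.sumAssoc _ _ _)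
      (Matrix.fromBlocks (Matrix.fromBlocks e.mat 0 0 f.mat) 0 0 g.mat) =
      Matrix.fromBlocks e.mat 0 0 (Matrix.fromBlocks f.mat 0 0 g.mat) := by
    ext i j
    rcases i with i | i | i <;> rcases j with j | j | j <;> rfl
  rw [h2] at h
  have hL := MatEquiv.trans hl ((e.add f).add g).idem
    (MatEquiv.blocks (add_equiv e f) (MatEquiv.refl g.idem)) (add_equiv (e.add f) g)
  have hR := MatEquiv.trans hr (e.add (f.add g)).idem
    (MatEquiv.blocks (MatEquiv.refl e.idem) (add_equiv f g)) (add_equiv e (f.add g))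
  exact MatEquiv.trans ((e.add f).add g).idem (e.add (f.add g)).idem
    (MatEquiv.trans ((e.add f).add g).idem hr hL.symm h) hR

end IdemMat

/-- The V-monoid of a unital ring: equivalence classes of idempotent matrices. -/
def VMonoid (R : Type*) [Ring R] : Type _ := Quotient (IdemMat.setoid R)

namespace VMonoid

variable {R : Type*} [Ring R]

/-- The class `[e]` of an idempotent matrix `e`. -/
def mk (e : IdemMat R) : VMonoid R := Quotient.mk _ e

instance : Zero (VMonoid R) := ⟨mk (IdemMat.zero R)⟩

instance : Add (VMonoid R) :=
  ⟨Quotient.map₂ IdemMat.add fun _ _ h _ _ h' => IdemMat.add_congr h h'⟩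

protected theorem add_comm' (a b : VMonoid R) : a + b = b + a :=
  Quotient.inductionOn₂ a b fun e f => Quotient.sound (IdemMat.add_comm_equiv e f)

protected theorem zero_add' (a : VMonoid R) : 0 + a = a :=
  Quotient.inductionOn a fun e => Quotient.sound (IdemMat.zero_add_equiv e)

/-- Addition in `V(R)` is `[e] + [f] = [e ⊕ f]`. -/
instance : AddCommMonoid (VMonoid R) where
  add_assoc a b c := Quotient.inductionOn₃ a b c fun e f g =>
    Quotient.sound (IdemMat.add_assoc_equiv e f g)
  zero_add := VMonoid.zero_add'
  add_zero a := (VMonoid.add_comm' a 0).trans (VMonoid.zero_add' a)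
  add_comm := VMonoid.add_comm'
  nsmul := nsmulRec

/-- The class `[1_R]`. -/
def unit (R : Type*) [Ring R] : VMonoid R := mk (IdemMat.ofElem 1 IsIdempotentElem.one)

/-- The monoid homomorphism `V(φ) : V(R) → V(S)` induced by a ring homomorphism `φ : R → S`. -/
def map {S : Type*} [Ring S] (φ : R →+* S) : VMonoid R →+ VMonoid S where
  toFun := Quotient.map (IdemMat.map φ) fun _ _ h => IdemMat.map_congr φ h
  map_zero' := by
    refine congrArg (Quotient.mk _) ?_
    simp only [IdemMat.map, IdemMat.zero]
    congr 1
    ext i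
    exact i.elim0
  map_add' a b := Quotient.inductionOn₂ a b fun e f => by
    refine congrArg (Quotient.mk _) ?_
    simp only [IdemMat.map, IdemMat.add]
    congr 1
    simp [Matrix.reindex_apply, ← Matrix.submatrix_map, Matrix.fromBlocks_map]
    rfl

/-- The monoid `V(I)` of an ideal `I`, identified with its image in `V(R)`: the classes of the
idempotent matrices with entries in `I`. -/
def ofIdeal (I : Ideal R) : AddSubmonoid (VMonoid R) where
  carrier := {a | ∃ e : IdemMat R, (∀ i j, e.mat i j ∈ I) ∧ mk e = a}
  zero_mem' := ⟨IdemMat.zero R, fun i => i.elim0, rfl⟩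
  add_mem' := by
    rintro _ _ ⟨e, he, rfl⟩ ⟨f, hf, rfl⟩
    have h : ∀ i j, Matrix.fromBlocks e.mat 0 0 f.mat i j ∈ I := by
      rintro (i | i) (j | j) <;> simp [he, hf]
    exact ⟨e.add f, fun i j => h (finSumFinEquiv.symm i) (finSumFinEquiv.symm j), rfl⟩

end VMonoid

/-! ### Rings -/

/-- A unital ring `R` is an exchange ring if for each `a ∈ R` there is an idempotent `e ∈ aR`
such that `1 - e ∈ (1 - a)R`. -/
def IsExchangeRing (R : Type*) [Ring R] : Prop :=
  ∀ a : R, ∃ e : R, IsIdempotentElem e ∧ (∃ r, e = a * r) ∧ ∃ s, 1 - e = (1 - a) * s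

/-- The (left) socle of a ring: the sum of its minimal left ideals. It equals the right socle
when the ring is semiprime. -/
def socle (R : Type*) [Ring R] : Ideal R := sSup {L : Ideal R | IsSimpleModule R L}

instance socle_isTwoSided (R : Type*) [Ring R] : (socle R).IsTwoSided where
  mul_mem_of_left {x} b hx := by
    have key : socle R ≤ Submodule.comap (LinearMap.toSpanSingleton R R b) (socle R) := by
      refine sSup_le fun L hL => ?_
      have hL' : IsSimpleModule R L := hL
      rw [← Submodule.map_le_iff_le_comap]
      let g : L →ₗ[R] R := (LinearMap.toSpanSingleton R R b).comp L.subtype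
      have hr : Submodule.map (LinearMap.toSpanSingleton R R b) L = LinearMap.range g := by
        rw [LinearMap.range_comp, Submodule.range_subtype]
      rw [hr]
      rcases LinearMap.injective_or_eq_zero g with h | h
      · exact le_sSup (IsSimpleModule.congr (LinearEquiv.ofInjective g h).symm)
      · rw [h, LinearMap.range_zero]
        exact bot_le
    simpa using key hx

/-- A two-sided ideal `I` is essential if it meets every nonzero two-sided ideal nontrivially. -/
def IsEssentialIdeal {R : Type*} [Ring R] (I : Ideal R) : Prop :=
  ∀ J : Ideal R, J.IsTwoSided → J ≠ ⊥ → I ⊓ J ≠ ⊥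

/-- The socle of a `K`-algebra, as a non-unital `K`-algebra. -/
def socleAlg (K R : Type*) [Field K] [Ring R] [Algebra K R] : NonUnitalSubalgebra K R where
  carrier := socle R
  zero_mem' := (socle R).zero_mem
  add_mem' := (socle R).add_mem
  mul_mem' {a _} _ hb := (socle R).mul_mem_left a hb
  smul_mem' c x hx := by
    rw [Algebra.smul_def]
    exact (socle R).mul_mem_left _ hx

/-- The non-unital `K`-algebra `⨁_{i ≥ 1} M_i(K)`: the finitely supported families in
`∏_{i ≥ 1} M_i(K)`, where the factor at `i : ℕ` is the algebra of matrices of size `i + 1`. -/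
def matrixSum (K : Type*) [Field K] :
    NonUnitalSubalgebra K ((i : ℕ) → Matrix (Fin (i + 1)) (Fin (i + 1)) K) where
  carrier := {f | {i | f i ≠ 0}.Finite}
  zero_mem' := by simp
  add_mem' {f g} hf hg := by
    refine (Set.Finite.union hf hg).subset fun i hi => ?_
    by_contra h
    simp only [Set.mem_union, Set.mem_ofPred_eq, not_or, not_not] at h
    exact hi (by simp [h.1, h.2])
  mul_mem' {f g} hf _ := by
    refine Set.Finite.subset hf fun i hi h => hi ?_
    simp only [Pi.mul_apply, h, zero_mul]
  smul_mem' c f hf := by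
    refine Set.Finite.subset hf fun i hi h => hi ?_
    simp only [Pi.smul_apply, h, smul_zero]

/-! Write `c_j` for the unit of the block `M_{j+1}(K)` of the socle; it is a central idempotent of
`R`. A class in `V(R)` is therefore determined by its ranks in the blocks `j < N` together with its
part outside them (`BlockIdeal.eq_of_cut_eq`). Two classes that agree modulo the socle have the same
outside part once `N` is large (`BlockIdeal.cut_eventually_eq`).

On the side of `𝓜`, an element is determined by the multiplicities `mult j` and three invariants
that vanish on every `a l`, hence factor through `𝓜 / ped 𝓜` (`ext_of_invariants`). The link is that
the rank of `τ m` in block `j` is `mult j m` (`rk_map`). Indeed `τ` matches the atoms `a i` with the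
rank-one classes of the blocks. Since `u` contains `i + 1` copies of `a i` and `1` has rank `j + 1`
in block `j`, the matching is the identity, and `eq_mult` shows that a homomorphism to `ℕ` is
determined by its values on the `a i` and on `u`.

Injectivity follows: ranks recover the multiplicities, the quotient recovers the rest. For
surjectivity, lift a class modulo the socle to `m : 𝓜`, choose `N` so that the outside parts agree,
and replace the multiplicities of the `a i` with `i < N` in `m` by the required ranks. -/

namespace MonM

/-! ### The presentation of `𝓜` and its universal property -/

open Gen

-- Fixes the reading of `n • m` through the monoid structure, where the `nsmul` lemmas apply.
noncomputable local instance (priority := 2000) natSMul : SMul ℕ MonM :=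
  @NSMul.toSMul MonM AddMonoid.toNSMul

theorem of_x_zero_add_y : of (x 0) + of (y 0) = of (x 0) + of (z 0) :=
  (addConGen Rel).eq.2 (AddConGen.Rel.of _ _ Rel.base)

theorem of_y (l : ℕ) : of (y l) = of (y (l + 1)) + of (a l) :=
  (addConGen Rel).eq.2 (AddConGen.Rel.of _ _ (Rel.ya l))

theorem of_z (l : ℕ) : of (z l) = of (z (l + 1)) + of (a l) :=
  (addConGen Rel).eq.2 (AddConGen.Rel.of _ _ (Rel.za l))

theorem of_x (l : ℕ) : of (x l) = of (x (l + 1)) + of (y (l + 1)) :=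
  (addConGen Rel).eq.2 (AddConGen.Rel.of _ _ (Rel.xy l))

theorem of_x' (l : ℕ) : of (x l) = of (x (l + 1)) + of (z (l + 1)) :=
  (addConGen Rel).eq.2 (AddConGen.Rel.of _ _ (Rel.xz l))

/-- Above level zero both sides are the generator `x` of the previous level. -/
theorem of_x_add_y (l : ℕ) : of (x l) + of (y l) = of (x l) + of (z l) := by
  cases l with
  | zero => exact of_x_zero_add_y
  | succ l => rw [← of_x, ← of_x']

theorem induction_on {p : MonM → Prop} (m : MonM) (zero : p 0)
    (of_add : ∀ g m, p m → p (of g + m)) : p m := by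
  induction m using AddCon.induction_on with
  | H f =>
    induction f using Finsupp.induction_linear with
    | zero => exact zero
    | add f g hf hg =>
      clear hf hg
      suffices h : ∀ (f : Gen →₀ ℕ) (m : MonM), p m → p ((addConGen Rel).mk' f + m) by
        have := h (f + g) 0 zero
        rwa [add_zero] at this
      intro f
      induction f using Finsupp.induction_linear with
      | zero => intro m hm; rwa [map_zero, zero_add]
      | add f g hf hg => intro m hm; rw [map_add, add_assoc]; exact hf _ (hg _ hm)
      | single g n =>
        induction n with
        | zero => intro m hm; rwa [Finsupp.single_zero, map_zero, zero_add]
        | succ n ih =>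
          intro m hm
          rw [Finsupp.single_add, map_add, add_assoc]
          exact ih _ (of_add _ _ hm)
    | single g n =>
      induction n with
      | zero => rw [Finsupp.single_zero]; exact zero
      | succ n ih =>
        rw [add_comm n 1, Finsupp.single_add]
        exact of_add _ _ ih

section lift

variable {A : Type*} [AddCommMonoid A]

/-- The homomorphism out of `MonM` with prescribed values on the generators. -/
noncomputable def lift (f : Gen → A) (base : f (x 0) + f (y 0) = f (x 0) + f (z 0))
    (ya : ∀ l, f (y l) = f (y (l + 1)) + f (a l)) (za : ∀ l, f (z l) = f (z (l + 1)) + f (a l))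
    (xy : ∀ l, f (x l) = f (x (l + 1)) + f (y (l + 1)))
    (xz : ∀ l, f (x l) = f (x (l + 1)) + f (z (l + 1))) : MonM →+ A :=
  (addConGen Rel).lift (Finsupp.liftAddHom fun g => multiplesHom A (f g)) <| by
    rw [AddCon.addConGen_le]
    rintro _ _ (_ | l | l | l | l) <;> rw [AddCon.ker_rel] <;>
      simp only [Gen.free, map_add, Finsupp.liftAddHom_apply_single, multiplesHom_apply,
        one_nsmul]
    · exact base
    · exact ya l
    · exact za l
    · exact xy l
    · exact xz l

@[simp]
theorem lift_of (f : Gen → A) (base ya za xy xz) (g : Gen) :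
    lift f base ya za xy xz (of g) = f g := by
  simp [lift, of, Gen.free]

theorem hom_ext {f g : MonM →+ A} (h : ∀ s, f (of s) = g (of s)) : f = g := by
  refine AddMonoidHom.ext fun m => ?_
  induction m using induction_on with
  | zero => simp
  | of_add s m ih => simp [h, ih]

end lift

/-! ### Additive invariants of `𝓜` -/

/-- The number of copies of `a j` that can be split off. -/
noncomputable def mult (j : ℕ) : MonM →+ ℕ :=
  lift (fun | x l => j - l | y l => if l ≤ j then 1 else 0 | z l => if l ≤ j then 1 else 0
            | a l => if l = j then 1 else 0)
    rfl (fun l => by grind) (fun l => by grind) (fun l => by grind) (fun l => by grind)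

@[simp] theorem mult_x (j l : ℕ) : mult j (of (x l)) = j - l := lift_of ..
@[simp] theorem mult_y (j l : ℕ) : mult j (of (y l)) = if l ≤ j then 1 else 0 := lift_of ..
@[simp] theorem mult_z (j l : ℕ) : mult j (of (z l)) = if l ≤ j then 1 else 0 := lift_of ..
@[simp] theorem mult_a (j l : ℕ) : mult j (of (a l)) = if l = j then 1 else 0 := lift_of ..

/-- The number of generators `x l` in an expression of an element. -/
noncomputable def xCount : MonM →+ ℕ :=
  lift (fun | x _ => 1 | _ => 0) (by simp) (by simp) (by simp) (by simp) (by simp)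

@[simp] theorem xCount_x (l : ℕ) : xCount (of (x l)) = 1 := lift_of ..
@[simp] theorem xCount_y (l : ℕ) : xCount (of (y l)) = 0 := lift_of ..
@[simp] theorem xCount_z (l : ℕ) : xCount (of (z l)) = 0 := lift_of ..
@[simp] theorem xCount_a (l : ℕ) : xCount (of (a l)) = 0 := lift_of ..

/-- The number of generators `y l` and `z l`, corrected by the levels of the generators `x l`. -/
noncomputable def weight : MonM →+ ℤ :=
  lift (fun | x l => -l | y _ => 1 | z _ => 1 | a _ => 0)
    (by simp) (by simp) (by simp) (by simp) (by simp)

@[simp] theorem weight_x (l : ℕ) : weight (of (x l)) = -l := lift_of ..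
@[simp] theorem weight_y (l : ℕ) : weight (of (y l)) = 1 := lift_of ..
@[simp] theorem weight_z (l : ℕ) : weight (of (z l)) = 1 := lift_of ..
@[simp] theorem weight_a (l : ℕ) : weight (of (a l)) = 0 := lift_of ..

/-- The number of generators `y l`, or `⊤` if some generator `x l` occurs. -/
noncomputable def yCount : MonM →+ ℕ∞ :=
  lift (fun | x _ => ⊤ | y _ => 1 | z _ => 0 | a _ => 0)
    (by simp) (by simp) (by simp) (by simp) (by simp)

@[simp] theorem yCount_x (l : ℕ) : yCount (of (x l)) = ⊤ := lift_of ..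
@[simp] theorem yCount_y (l : ℕ) : yCount (of (y l)) = 1 := lift_of ..
@[simp] theorem yCount_z (l : ℕ) : yCount (of (z l)) = 0 := lift_of ..
@[simp] theorem yCount_a (l : ℕ) : yCount (of (a l)) = 0 := lift_of ..

/-! ### Normal forms at level `N` -/

/-- The element `X x_N + Y y_N + Z z_N + ∑_{i < N} c_i a_i`. -/
noncomputable def levelForm (N X Y Z : ℕ) (c : ℕ → ℕ) : MonM :=
  X • of (x N) + Y • of (y N) + Z • of (z N) + ∑ i ∈ Finset.range N, c i • of (a i)

/-- Each `x N` releases a new `y (N + 1)`, and each `y N` or `z N` releases one `a N`; this accounts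
for `X + Y` and for `hc`. -/
theorem levelForm_succ (N X Y Z : ℕ) (c : ℕ → ℕ) (hc : c N = Y + Z) :
    levelForm N X Y Z c = levelForm (N + 1) X (X + Y) Z c := by
  simp only [levelForm, Finset.sum_range_succ, hc, of_x N, of_y N, of_z N, nsmul_add, add_nsmul]
  abel

theorem mult_levelForm_of_lt {N X Y Z : ℕ} {c : ℕ → ℕ} {i : ℕ} (hi : i < N) :
    mult i (levelForm N X Y Z c) = c i := by
  have h : ¬ N ≤ i := by omega
  simp [levelForm, h, hi.le, Finset.sum_ite_eq', hi]

theorem mult_levelForm_self {N X Y Z : ℕ} {c : ℕ → ℕ} :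
    mult N (levelForm N X Y Z c) = Y + Z := by
  simp [levelForm]

theorem xCount_levelForm {N X Y Z : ℕ} {c : ℕ → ℕ} :
    xCount (levelForm N X Y Z c) = X := by
  simp [levelForm]

theorem weight_levelForm {N X Y Z : ℕ} {c : ℕ → ℕ} :
    weight (levelForm N X Y Z c) = -(X * N) + Y + Z := by
  simp [levelForm]

theorem yCount_levelForm_zero {N Y Z : ℕ} {c : ℕ → ℕ} :
    yCount (levelForm N 0 Y Z c) = Y := by
  simp [levelForm]

/-- A single `x N` erases the difference between `y N` and `z N`, so only `Y + Z` matters. -/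
theorem levelForm_of_pos (N X Y Z : ℕ) (c : ℕ → ℕ) :
    levelForm N (X + 1) Y Z c = levelForm N (X + 1) (Y + Z) 0 c := by
  have h : ∀ Z : ℕ, of (x N) + Z • of (z N) = of (x N) + Z • of (y N) := by
    intro Z
    induction Z with
    | zero => simp
    | succ Z ih =>
      rw [succ_nsmul, succ_nsmul, ← add_assoc, ih, add_right_comm, ← of_x_add_y, add_right_comm,
        add_assoc]
  simp only [levelForm]
  congr 1
  calc (X + 1) • of (x N) + Y • of (y N) + Z • of (z N)
      = X • of (x N) + Y • of (y N) + (of (x N) + Z • of (z N)) := by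
        rw [succ_nsmul]; abel
    _ = _ := by rw [h, succ_nsmul, add_nsmul, zero_nsmul]; abel

/-- `m` is expressible by the generators of level `N`. -/
def IsLevel (N : ℕ) (m : MonM) : Prop :=
  ∃ X Y Z, m = levelForm N X Y Z fun i => mult i m

/-- The coefficients below level `N` are forced: `mult i` reads them off. -/
theorem isLevel_of_eq {N X Y Z : ℕ} {c : ℕ → ℕ} {m : MonM} (h : m = levelForm N X Y Z c) :
    IsLevel N m := by
  refine ⟨X, Y, Z, h.trans ?_⟩
  unfold levelForm
  congr 1
  refine Finset.sum_congr rfl fun i hi => ?_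
  simp only [h, mult_levelForm_of_lt (Finset.mem_range.1 hi)]

theorem IsLevel.succ {N : ℕ} {m : MonM} (h : IsLevel N m) : IsLevel (N + 1) m := by
  obtain ⟨X, Y, Z, hm⟩ := h
  refine isLevel_of_eq (hm.trans (levelForm_succ _ _ _ _ _ ?_))
  rw [hm, mult_levelForm_self]

theorem IsLevel.mono {N N' : ℕ} (hN : N ≤ N') {m : MonM} (h : IsLevel N m) : IsLevel N' m := by
  induction N', hN using Nat.le_induction with
  | base => exact h
  | succ N' _ ih => exact ih.succ

theorem IsLevel.add {N : ℕ} {m m' : MonM} (h : IsLevel N m) (h' : IsLevel N m') :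
    IsLevel N (m + m') := by
  obtain ⟨X, Y, Z, hm⟩ := h
  obtain ⟨X', Y', Z', hm'⟩ := h'
  refine isLevel_of_eq (X := X + X') (Y := Y + Y') (Z := Z + Z')
    (c := fun i => mult i m + mult i m') ?_
  conv_lhs => rw [hm, hm']
  simp only [levelForm, add_nsmul, Finset.sum_add_distrib]
  abel

theorem exists_isLevel_of (g : Gen) : ∃ N, IsLevel N (of g) := by
  cases g with
  | x l => exact ⟨l, isLevel_of_eq (X := 1) (Y := 0) (Z := 0) (c := 0) (by simp [levelForm])⟩
  | y l => exact ⟨l, isLevel_of_eq (X := 0) (Y := 1) (Z := 0) (c := 0) (by simp [levelForm])⟩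
  | z l => exact ⟨l, isLevel_of_eq (X := 0) (Y := 0) (Z := 1) (c := 0) (by simp [levelForm])⟩
  | a l =>
    refine ⟨l + 1, isLevel_of_eq (X := 0) (Y := 0) (Z := 0) (c := Pi.single l 1) ?_⟩
    rw [levelForm, Finset.sum_eq_single l] <;> simp +contextual

theorem exists_isLevel (m : MonM) : ∃ N, ∀ N', N ≤ N' → IsLevel N' m := by
  induction m using induction_on with
  | zero => exact ⟨0, fun N _ => isLevel_of_eq (X := 0) (Y := 0) (Z := 0) (c := 0)
      (by simp [levelForm])⟩
  | of_add g m ih =>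
    obtain ⟨N, hN⟩ := ih
    obtain ⟨N', hN'⟩ := exists_isLevel_of g
    exact ⟨max N N', fun M hM => (hN'.mono (le_of_max_le_right hM)).add
      (hN M (le_of_max_le_left hM))⟩

/-- Bring both elements to a common level. Multiplicities give the coefficients of the `a i`,
`xCount` gives `X`, and then `weight` gives `Y + Z`. If `X = 0`, `yCount` separates `Y` from `Z`; if
`X > 0`, the sum suffices. -/
theorem ext_of_invariants {m m' : MonM} (hx : xCount m = xCount m') (hw : weight m = weight m')
    (hy : yCount m = yCount m') (hr : ∀ j, mult j m = mult j m') : m = m' := by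
  obtain ⟨N₁, h₁⟩ := exists_isLevel m
  obtain ⟨N₂, h₂⟩ := exists_isLevel m'
  obtain ⟨X, Y, Z, hm⟩ := h₁ (max N₁ N₂) (le_max_left _ _)
  obtain ⟨X', Y', Z', hm'⟩ := h₂ (max N₁ N₂) (le_max_right _ _)
  generalize max N₁ N₂ = N at hm hm'
  have hc : (fun i => mult i m) = fun i => mult i m' := funext hr
  rw [hc] at hm
  generalize (fun i => mult i m') = c at hm hm'
  subst hm hm'
  rw [xCount_levelForm, xCount_levelForm] at hx
  subst hx
  rw [weight_levelForm, weight_levelForm] at hw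
  cases X with
  | zero =>
    rw [yCount_levelForm_zero, yCount_levelForm_zero, Nat.cast_inj] at hy
    obtain rfl : Z = Z' := by omega
    rw [hy]
  | succ X =>
    rw [levelForm_of_pos, levelForm_of_pos N X Y']
    congr 1
    omega

theorem exists_eq_add_sum (m : MonM) (N : ℕ) :
    ∃ m', m = m' + ∑ i ∈ Finset.range N, mult i m • of (a i) := by
  obtain ⟨N', h⟩ := exists_isLevel m
  obtain ⟨X, Y, Z, hm⟩ := h (N + N') (Nat.le_add_left _ _)
  rw [levelForm, Finset.sum_range_add] at hm
  refine ⟨X • of (x (N + N')) + Y • of (y (N + N')) + Z • of (z (N + N')) +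
    ∑ i ∈ Finset.range N', mult (N + i) m • of (a (N + i)), ?_⟩
  conv_lhs => rw [hm]
  abel

/-! ### Irreducible elements and the pedestal -/

theorem exists_mult_of_pos (g : Gen) : ∃ j, 0 < mult j (of g) := by
  cases g with
  | x l => exact ⟨l + 1, by simp⟩
  | y l => exact ⟨l, by simp⟩
  | z l => exact ⟨l, by simp⟩
  | a l => exact ⟨l, by simp⟩

theorem of_ne_zero (g : Gen) : of g ≠ 0 := by
  intro h
  obtain ⟨j, hj⟩ := exists_mult_of_pos g
  simp [h] at hj

theorem eq_zero_of_mult {m : MonM} (h : ∀ j, mult j m = 0) : m = 0 := by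
  induction m using induction_on with
  | zero => rfl
  | of_add g m _ =>
    obtain ⟨j, hj⟩ := exists_mult_of_pos g
    have := h j
    rw [map_add] at this
    omega

/-- The multiplicities of the two summands add up to a single `1`, so one summand has none and is
zero. -/
theorem isIrred_of_a (l : ℕ) : CMon.IsIrred (of (a l)) := by
  refine ⟨of_ne_zero _, fun m m' h => ?_⟩
  have h' : ∀ j, mult j m + mult j m' = if l = j then 1 else 0 := fun j => by
    rw [← map_add, h, mult_a]
  have hl := h' l
  rw [if_pos rfl] at hl
  rcases Nat.eq_zero_or_pos (mult l m) with h0 | h0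
  · refine .inl (eq_zero_of_mult fun j => ?_)
    have := h' j
    grind
  · refine .inr (eq_zero_of_mult fun j => ?_)
    have := h' j
    grind

/-- An irreducible element is a generator, and the relations split every other generator into two
nonzero terms. -/
theorem exists_eq_of_isIrred {m : MonM} (h : CMon.IsIrred m) : ∃ l, m = of (a l) := by
  have key : ∃ g, m = of g := by
    induction m using induction_on with
    | zero => exact absurd rfl h.1
    | of_add g m _ =>
      rcases h.2 _ _ rfl with h0 | h0
      · exact absurd h0 (of_ne_zero g)
      · exact ⟨g, by rw [h0, add_zero]⟩
  obtain ⟨g, rfl⟩ := key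
  cases g with
  | x l => rcases h.2 _ _ (of_x l).symm with h | h <;> exact absurd h (of_ne_zero _)
  | y l => rcases h.2 _ _ (of_y l).symm with h | h <;> exact absurd h (of_ne_zero _)
  | z l => rcases h.2 _ _ (of_z l).symm with h | h <;> exact absurd h (of_ne_zero _)
  | a l => exact ⟨l, rfl⟩

theorem of_a_mem_ped (l : ℕ) : of (a l) ∈ CMon.ped MonM :=
  AddSubmonoid.subset_closure (isIrred_of_a l)

theorem mem_ped_cases {m : MonM} (hm : m ∈ CMon.ped MonM) :
    m = 0 ∨ ∃ l, ∃ m' ∈ CMon.ped MonM, m = of (a l) + m' := by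
  induction hm using AddSubmonoid.closure_induction with
  | mem m h =>
    obtain ⟨l, rfl⟩ := exists_eq_of_isIrred h
    exact .inr ⟨l, 0, zero_mem _, (add_zero _).symm⟩
  | zero => exact .inl rfl
  | add m m' hm hm' ih ih' =>
    rcases ih with rfl | ⟨l, n, hn, rfl⟩
    · rwa [zero_add]
    · exact .inr ⟨l, n + m', add_mem hn hm', add_assoc _ _ _⟩

/-! ### Rigidity of homomorphisms from `𝓜` to `ℕ` -/

theorem mult_u (j : ℕ) : mult j u = j + 1 := by simp [u]

theorem succ_mul_map_le (ρ : MonM →+ ℕ) (i : ℕ) : (i + 1) * ρ (of (a i)) ≤ ρ u := by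
  obtain ⟨m, hm⟩ := exists_eq_add_sum u (i + 1)
  rw [hm, Finset.sum_range_succ, mult_u, map_add, map_add, map_nsmul, smul_eq_mul]
  omega

/-- Beyond level `j` the value on `y l` is constant, and it must be `0`. Descending gives all `y l`,
then `ρ u` gives `x 0`, the relations give all `x l`, and cancellation in `ℕ` gives the `z l`. -/
theorem eq_mult {ρ : MonM →+ ℕ} {j : ℕ} (ha : ∀ i, ρ (of (a i)) = if i = j then 1 else 0)
    (hu : ρ u = j + 1) : ρ = mult j := by
  have hx : ∀ l, ρ (of (x l)) = ρ (of (x (l + 1))) + ρ (of (y (l + 1))) := fun l => by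
    rw [of_x, map_add]
  have hy : ∀ l, ρ (of (y l)) = ρ (of (y (l + 1))) + if l = j then 1 else 0 := fun l => by
    rw [of_y, map_add, ha]
  have hyc : ∀ n, ρ (of (y (j + 1 + n))) = ρ (of (y (j + 1))) := by
    intro n
    induction n with
    | zero => rfl
    | succ n ih =>
      have := hy (j + 1 + n)
      rw [if_neg (by omega)] at this
      rw [← ih, this]
      rfl
  have hxc : ∀ n, ρ (of (x j)) = ρ (of (x (j + n))) + n * ρ (of (y (j + 1))) := by
    intro n
    induction n with
    | zero => simp
    | succ n ih =>
      have h1 := hx (j + n)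
      have h2 := hyc n
      rw [show j + 1 + n = j + n + 1 by omega] at h2
      rw [ih, h1, h2, ← add_assoc j n 1]
      ring
  -- Otherwise `x j` would contain arbitrarily many terms of positive value; `ρ (x j) + 1` of them
  -- already exceed `ρ (x j)`.
  have hy0 : ρ (of (y (j + 1))) = 0 := by
    by_contra h
    have h1 := hxc (ρ (of (x j)) + 1)
    have h2 : ρ (of (x j)) + 1 ≤ (ρ (of (x j)) + 1) * ρ (of (y (j + 1))) :=
      Nat.le_mul_of_pos_right _ (Nat.pos_of_ne_zero h)
    omega
  have hyl : ∀ l, ρ (of (y l)) = if l ≤ j then 1 else 0 := by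
    intro l
    rcases Nat.lt_or_ge j l with h | h
    · obtain ⟨n, rfl⟩ := Nat.exists_eq_add_of_lt h
      rw [if_neg (by omega), show j + n + 1 = j + 1 + n by omega, hyc, hy0]
    · induction h using Nat.decreasingInduction with
      | self => rw [hy, hy0]; simp
      | of_succ l hl ih =>
        rw [hy, ih]
        grind
  have hxl : ∀ l, ρ (of (x l)) = j - l := by
    intro l
    induction l with
    | zero =>
      have := hyl 0
      rw [u, map_add] at hu
      simp at this
      omega
    | succ l ih =>
      have h1 := hx l
      have h2 := hyl (l + 1)
      grind
  refine hom_ext fun g => ?_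
  cases g with
  | x l => rw [hxl, mult_x]
  | y l => rw [hyl, mult_y]
  | z l =>
    have h := congrArg ρ (of_x_add_y l)
    rw [map_add, map_add] at h
    rw [mult_z, ← hyl]
    omega
  | a l => rw [ha, mult_a]

end MonM

/-! ### Idempotent matrices over a field -/

section Field

variable {K : Type*} [Field K] {ι κ : Type*} [Fintype ι] [Fintype κ]

/-- An idempotent factors as the projection onto its range followed by the inclusion, and the
opposite composite is the identity of the range. -/
theorem MatEquiv.one_of_rank [DecidableEq ι] {e : Matrix ι ι K} (he : IsIdempotentElem e) :
    MatEquiv e (1 : Matrix (Fin e.rank) (Fin e.rank) K) := by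
  let f : (ι → K) →ₗ[K] (ι → K) := e.toLin'
  have hf : f ∘ₗ f = f := by
    change e.toLin' ∘ₗ e.toLin' = e.toLin'
    rw [← Matrix.toLin'_mul, he.eq]
  have hr : Module.finrank K (LinearMap.range f) = Module.finrank K (Fin e.rank → K) := by
    rw [Module.finrank_fin_fun]
    rfl
  let g : LinearMap.range f ≃ₗ[K] (Fin e.rank → K) := LinearEquiv.ofFinrankEq _ _ hr
  let U : (Fin e.rank → K) →ₗ[K] (ι → K) := (LinearMap.range f).subtype ∘ₗ g.symm.toLinearMap
  let V : (ι → K) →ₗ[K] (Fin e.rank → K) := g.toLinearMap ∘ₗ f.rangeRestrict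
  have hUV : U ∘ₗ V = f := by ext x; simp [U, V]
  have hVU : V ∘ₗ U = LinearMap.id := by
    refine LinearMap.ext fun x => ?_
    have h : ∀ w : LinearMap.range f, f.rangeRestrict w = w := by
      rintro ⟨_, w, rfl⟩
      exact Subtype.ext (LinearMap.congr_fun hf w)
    simp [U, V, h]
  refine ⟨LinearMap.toMatrix' U, LinearMap.toMatrix' V, ?_, ?_⟩
  · rw [← LinearMap.toMatrix'_comp, hUV]
    exact LinearMap.toMatrix'_toLin' e
  · rw [← LinearMap.toMatrix'_comp, hVU, LinearMap.toMatrix'_id]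

theorem MatEquiv.rank_eq {e : Matrix ι ι K} {f : Matrix κ κ K} (he : IsIdempotentElem e)
    (hf : IsIdempotentElem f) (h : MatEquiv e f) : e.rank = f.rank := by
  obtain ⟨u, v, huv, hvu⟩ := h
  refine le_antisymm ?_ ?_
  · have : e = u * (f * v) := by
      rw [← hvu, ← he.eq, ← huv]
      simp only [Matrix.mul_assoc]
    rw [this]
    exact (Matrix.rank_mul_le_right _ _).trans (Matrix.rank_mul_le_left _ _)
  · have : f = v * (e * u) := by
      rw [← huv, ← hf.eq, ← hvu]
      simp only [Matrix.mul_assoc]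
    rw [this]
    exact (Matrix.rank_mul_le_right _ _).trans (Matrix.rank_mul_le_left _ _)

theorem MatEquiv.of_rank_eq {e : Matrix ι ι K} {f : Matrix κ κ K} (he : IsIdempotentElem e)
    (hf : IsIdempotentElem f) (h : e.rank = f.rank) : MatEquiv e f := by
  classical
  have h1 := MatEquiv.one_of_rank he
  rw [h] at h1
  exact h1.trans he hf (MatEquiv.one_of_rank hf).symm

theorem rank_blocks_of_idem {e : Matrix ι ι K} {f : Matrix κ κ K} (he : IsIdempotentElem e)
    (hf : IsIdempotentElem f) : (Matrix.fromBlocks e 0 0 f).rank = e.rank + f.rank := by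
  classical
  have h := MatEquiv.blocks (MatEquiv.one_of_rank he) (MatEquiv.one_of_rank hf)
  rw [Matrix.fromBlocks_one] at h
  rw [h.rank_eq (isIdempotentElem_blocks he hf) IsIdempotentElem.one, Matrix.rank_one]
  simp

end Field

/-! ### Matrices of matrices -/

section Comp

open Matrix

variable {K : Type*} [Field K] {n ι κ : Type*} [Fintype n] [Fintype ι] [Fintype κ]

theorem comp_mul_comp {ι l : Type*} (u : Matrix ι κ (Matrix n n K)) (v : Matrix κ l (Matrix n n K)) :
    comp ι κ n n K u * comp κ l n n K v = comp ι l n n K (u * v) := by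
  ext ⟨i, a⟩ ⟨j, b⟩
  simp [Matrix.mul_apply, Fintype.sum_prod_type, Matrix.sum_apply]

theorem isIdempotentElem_comp {e : Matrix ι ι (Matrix n n K)} (he : IsIdempotentElem e) :
    IsIdempotentElem (comp ι ι n n K e) := by
  rw [IsIdempotentElem, comp_mul_comp, he.eq]

/-- Flattening is bijective and multiplicative on rectangular matrices, so questions over `M_n(K)`
reduce to rank over `K`. -/
theorem matEquiv_comp_iff [DecidableEq n] {e : Matrix ι ι (Matrix n n K)} {f : Matrix κ κ (Matrix n n K)} :
    MatEquiv (comp ι ι n n K e) (comp κ κ n n K f) ↔ MatEquiv e f := by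
  constructor
  · rintro ⟨u, v, huv, hvu⟩
    obtain ⟨u, rfl⟩ := (comp ι κ n n K).surjective u
    obtain ⟨v, rfl⟩ := (comp κ ι n n K).surjective v
    rw [comp_mul_comp, EmbeddingLike.apply_eq_iff_eq] at huv hvu
    exact ⟨u, v, huv, hvu⟩
  · rintro ⟨u, v, rfl, rfl⟩
    exact ⟨comp ι κ n n K u, comp κ ι n n K v, comp_mul_comp u v, comp_mul_comp v u⟩

theorem rank_comp_blocks {e : Matrix ι ι (Matrix n n K)} {f : Matrix κ κ (Matrix n n K)}
    (he : IsIdempotentElem e) (hf : IsIdempotentElem f) :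
    (comp _ _ n n K (fromBlocks e 0 0 f)).rank =
      (comp _ _ n n K e).rank + (comp _ _ n n K f).rank := by
  have h : comp _ _ n n K (fromBlocks e 0 0 f) =
      Matrix.reindex (Equiv.sumProdDistrib ι κ n).symm (Equiv.sumProdDistrib ι κ n).symm
        (fromBlocks (comp _ _ n n K e) 0 0 (comp _ _ n n K f)) := by
    ext ⟨i | i, a⟩ ⟨j | j, b⟩ <;> rfl
  rw [h, Matrix.rank_reindex,
    rank_blocks_of_idem (isIdempotentElem_comp he) (isIdempotentElem_comp hf)]

theorem rank_comp_of_one [DecidableEq n] :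
    (comp (Fin 1) (Fin 1) n n K (Matrix.of fun _ _ => 1)).rank = Fintype.card n := by
  have : comp (Fin 1) (Fin 1) n n K (Matrix.of fun _ _ => 1) = 1 := by
    ext ⟨i, a⟩ ⟨j, b⟩
    obtain rfl : i = j := Subsingleton.elim _ _
    simp [Matrix.one_apply]
  rw [this, Matrix.rank_one]
  simp

theorem matEquiv_comp_of_single [DecidableEq n] (i : n) :
    MatEquiv (comp (Fin 1) (Fin 1) n n K (Matrix.of fun _ _ => Matrix.single i i 1))
      (1 : Matrix Unit Unit K) := by
  refine ⟨Matrix.of fun p _ => if p.2 = i then 1 else 0,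
    Matrix.of fun _ p => if p.2 = i then 1 else 0, ?_, ?_⟩
  · ext ⟨j, a⟩ ⟨k, b⟩
    simp [Matrix.mul_apply, Matrix.single_apply]
    grind
  · ext
    simp [Matrix.mul_apply, Fintype.sum_prod_type]

theorem isIdempotentElem_of_single [DecidableEq n] (i : n) :
    IsIdempotentElem (Matrix.of fun _ _ : Fin 1 => Matrix.single i i (1 : K)) := by
  ext
  simp [Matrix.mul_apply]

theorem rank_comp_of_single [DecidableEq n] (i : n) :
    (comp (Fin 1) (Fin 1) n n K (Matrix.of fun _ _ => Matrix.single i i 1)).rank = 1 := by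
  rw [(matEquiv_comp_of_single i).rank_eq (isIdempotentElem_comp (isIdempotentElem_of_single i))
    IsIdempotentElem.one, Matrix.rank_one]
  simp

end Comp

/-! ### Rank on the V-monoid of a matrix algebra -/

namespace VMonoid

/-- The rank over `K` of an idempotent matrix over `M_n(K)`. -/
noncomputable def rank (K n : Type*) [Field K] [Fintype n] [DecidableEq n] :
    VMonoid (Matrix n n K) →+ ℕ where
  toFun := Quotient.lift (fun e => (Matrix.comp _ _ n n K e.mat).rank) fun e f h =>
    (matEquiv_comp_iff.2 h).rank_eq (isIdempotentElem_comp e.idem) (isIdempotentElem_comp f.idem)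
  map_zero' := by
    change (Matrix.comp (Fin 0) (Fin 0) n n K _).rank = 0
    exact Nat.le_zero.1 ((Matrix.rank_le_card_width _).trans (by simp))
  map_add' a b := Quotient.inductionOn₂ a b fun e f => by
    change (Matrix.comp _ _ n n K (e.add f).mat).rank = _
    rw [← (matEquiv_comp_iff.2 (IdemMat.add_equiv e f)).rank_eq
      (isIdempotentElem_comp (isIdempotentElem_blocks e.idem f.idem))
      (isIdempotentElem_comp (e.add f).idem), rank_comp_blocks e.idem f.idem]
    rfl

section

variable {K n : Type*} [Field K] [Fintype n] [DecidableEq n]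

theorem rank_injective : Function.Injective (rank K n) := by
  intro a b
  refine Quotient.inductionOn₂ a b fun e f h => Quotient.sound ?_
  exact matEquiv_comp_iff.1
    (MatEquiv.of_rank_eq (isIdempotentElem_comp e.idem) (isIdempotentElem_comp f.idem) h)

theorem rank_unit : rank K n (unit _) = Fintype.card n :=
  rank_comp_of_one

theorem exists_rank_eq_one [Nonempty n] : ∃ a, rank K n a = 1 := by
  obtain ⟨i⟩ := ‹Nonempty n›
  exact ⟨mk ⟨1, _, isIdempotentElem_of_single i⟩, rank_comp_of_single i⟩

end

end VMonoid

/-! ### Functoriality of the V-monoid in non-unital ring homomorphisms -/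

/-- Applying a non-unital ring homomorphism entrywise. -/
def IdemMat.nonUnitalMap {R S : Type*} [Ring R] [Ring S] (φ : R →ₙ+* S) (e : IdemMat R) :
    IdemMat S where
  size := e.size
  mat := e.mat.map φ
  idem := by
    unfold IsIdempotentElem
    rw [← Matrix.map_mul, e.idem.eq]

theorem MatEquiv.map {R S ι κ : Type*} [Ring R] [Ring S] [Fintype ι] [Fintype κ] (φ : R →ₙ+* S)
    {e : Matrix ι ι R} {f : Matrix κ κ R} (h : MatEquiv e f) :
    MatEquiv (e.map φ) (f.map φ) := by
  obtain ⟨u, v, rfl, rfl⟩ := h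
  exact ⟨u.map φ, v.map φ, by rw [← Matrix.map_mul], by rw [← Matrix.map_mul]⟩

namespace VMonoid

variable {R S T : Type*} [Ring R] [Ring S] [Ring T]

/-- The monoid homomorphism `V(R) → V(S)` induced by a non-unital ring homomorphism `R → S`. -/
def nonUnitalMap (φ : R →ₙ+* S) : VMonoid R →+ VMonoid S where
  toFun := Quotient.map (IdemMat.nonUnitalMap φ) fun _ _ h => MatEquiv.map φ h
  map_zero' := by
    refine congrArg (Quotient.mk _) ?_
    simp only [IdemMat.nonUnitalMap, IdemMat.zero]
    congr 1
    ext i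
    exact i.elim0
  map_add' a b := Quotient.inductionOn₂ a b fun e f => by
    refine congrArg (Quotient.mk _) ?_
    simp only [IdemMat.nonUnitalMap, IdemMat.add]
    congr 1
    simp [Matrix.reindex_apply, ← Matrix.submatrix_map, Matrix.fromBlocks_map]
    rfl

theorem map_eq_nonUnitalMap (φ : R →+* S) : map φ = nonUnitalMap (φ : R →ₙ+* S) := rfl

theorem nonUnitalMap_nonUnitalMap (φ : R →ₙ+* S) (ψ : S →ₙ+* T) (a : VMonoid R) :
    nonUnitalMap ψ (nonUnitalMap φ a) = nonUnitalMap (ψ.comp φ) a :=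
  Quotient.inductionOn a fun _ => rfl

theorem mk_eq_zero {e : IdemMat R} (h : e.mat = 0) : mk e = 0 := by
  refine Quotient.sound ?_
  exact ⟨0, 0, by rw [h, Matrix.zero_mul], Matrix.ext fun i => i.elim0⟩

theorem nonUnitalMap_eq_zero {φ : R →ₙ+* S} {e : IdemMat R} (h : ∀ i j, φ (e.mat i j) = 0) :
    nonUnitalMap φ (mk e) = 0 :=
  mk_eq_zero (Matrix.ext h)

theorem nonUnitalMap_of_forall_eq_zero {φ : R →ₙ+* S} (h : ∀ r, φ r = 0) (a : VMonoid R) :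
    nonUnitalMap φ a = 0 :=
  Quotient.inductionOn a fun _ => nonUnitalMap_eq_zero fun _ _ => h _

theorem nonUnitalMap_id {φ : R →ₙ+* R} (h : ∀ r, φ r = r) (a : VMonoid R) :
    nonUnitalMap φ a = a := by
  obtain rfl : φ = NonUnitalRingHom.id R := NonUnitalRingHom.ext h
  exact Quotient.inductionOn a fun _ => rfl

/-- The row `(φ e, ψ e)` times the corresponding column is `χ e`; in the other order, orthogonality
kills the off-diagonal blocks. -/
theorem nonUnitalMap_add {χ φ ψ : R →ₙ+* S} (h : ∀ r, χ r = φ r + ψ r)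
    (h₁ : ∀ r s, φ r * ψ s = 0) (h₂ : ∀ r s, ψ r * φ s = 0) (a : VMonoid R) :
    nonUnitalMap χ a = nonUnitalMap φ a + nonUnitalMap ψ a := by
  refine Quotient.inductionOn a fun e => Quotient.sound ?_
  refine MatEquiv.trans (IdemMat.idem _) (IdemMat.idem _) ?_ (IdemMat.add_equiv _ _)
  have hφ : e.mat.map φ * e.mat.map φ = e.mat.map φ := (e.nonUnitalMap φ).idem
  have hψ : e.mat.map ψ * e.mat.map ψ = e.mat.map ψ := (e.nonUnitalMap ψ).idem
  have hφψ : e.mat.map φ * e.mat.map ψ = 0 := by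
    ext i j
    simp [Matrix.mul_apply, h₁]
  have hψφ : e.mat.map ψ * e.mat.map φ = 0 := by
    ext i j
    simp [Matrix.mul_apply, h₂]
  have hχ : e.mat.map χ = e.mat.map φ + e.mat.map ψ := by
    ext i j
    simp [h]
  have key : MatEquiv (e.mat.map χ) (Matrix.fromBlocks (e.mat.map φ) 0 0 (e.mat.map ψ)) := by
    refine ⟨Matrix.fromCols (e.mat.map φ) (e.mat.map ψ), Matrix.fromRows (e.mat.map φ)
      (e.mat.map ψ), ?_, ?_⟩
    · rw [Matrix.fromCols_mul_fromRows, hφ, hψ, hχ]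
    · rw [Matrix.fromRows_mul_fromCols, hφ, hψ, hφψ, hψφ]
  exact key

end VMonoid

/-! ### Splitting classes along the blocks of an ideal -/

/-- Multiplication by a central idempotent. -/
def mulCentral {R : Type*} [Ring R] (d : R) (hd : IsIdempotentElem d) (hc : ∀ r, Commute d r) :
    R →ₙ+* R where
  toFun r := r * d
  map_zero' := zero_mul d
  map_add' r s := add_mul r s d
  map_mul' r s := by
    rw [mul_assoc r d, ← mul_assoc d s, (hc s).eq, mul_assoc s d d, hd.eq, mul_assoc]

/-- A decomposition of a two-sided ideal `I` of `R` as a direct sum of the ideals `R c_j`, for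
orthogonal central idempotents `c_j` of `R` with `R c_j ≅ M_{j + 1}(K)`. -/
structure BlockIdeal (K : Type*) {R : Type*} [Field K] [Ring R] (I : Ideal R) where
  /-- The projection of `R` onto a block. -/
  proj (j : ℕ) : R →+* Matrix (Fin (j + 1)) (Fin (j + 1)) K
  /-- The inclusion of a block in `R`. -/
  incl (j : ℕ) : Matrix (Fin (j + 1)) (Fin (j + 1)) K →ₙ+* R
  proj_incl (j : ℕ) (X) : proj j (incl j X) = X
  incl_proj (j : ℕ) (r : R) : incl j (proj j r) = r * incl j 1
  central (j : ℕ) (r : R) : Commute (incl j 1) r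
  orthogonal {i j : ℕ} (h : i ≠ j) : incl i 1 * incl j 1 = 0
  incl_mem (j : ℕ) (X) : incl j X ∈ I
  eventually_eq {s : R} (hs : s ∈ I) :
    ∃ N, ∀ N', N ≤ N' → s * ∑ j ∈ Finset.range N', incl j 1 = s

namespace BlockIdeal

variable {K R : Type*} [Field K] [Ring R] {I : Ideal R} (B : BlockIdeal K I)

/-- The unit of a block. -/
def c (j : ℕ) : R := B.incl j 1

/-- The unit of the complement of the first `N` blocks. -/
def d (N : ℕ) : R := 1 - ∑ j ∈ Finset.range N, B.c j

theorem c_idem (j : ℕ) : IsIdempotentElem (B.c j) := by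
  rw [c, IsIdempotentElem, ← map_mul, mul_one]

theorem c_central (j : ℕ) (r : R) : Commute (B.c j) r := B.central j r

theorem c_mul_c {i j : ℕ} (h : i ≠ j) : B.c i * B.c j = 0 := B.orthogonal h

theorem d_central (N : ℕ) (r : R) : Commute (B.d N) r :=
  (Commute.one_left r).sub_left (Commute.sum_left _ _ _ fun j _ => B.c_central j r)

theorem d_mul_c (N j : ℕ) : B.d N * B.c j = if j < N then 0 else B.c j := by
  rw [d, sub_mul, one_mul, Finset.sum_mul]
  split_ifs with h
  · rw [Finset.sum_eq_single j (fun i _ hi => B.c_mul_c hi) (by simp [h]), (B.c_idem j).eq,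
      sub_self]
  · rw [Finset.sum_eq_zero, sub_zero]
    intro i hi
    rw [Finset.mem_range] at hi
    exact B.c_mul_c (by omega)

theorem d_idem (N : ℕ) : IsIdempotentElem (B.d N) := by
  rw [IsIdempotentElem]
  conv_lhs => enter [2]; rw [d]
  rw [mul_sub, mul_one, Finset.mul_sum, Finset.sum_eq_zero, sub_zero]
  intro j hj
  rw [d_mul_c, if_pos (Finset.mem_range.1 hj)]

theorem d_succ (N : ℕ) : B.d N = B.d (N + 1) + B.c N := by
  rw [d, d, Finset.sum_range_succ]
  abel

theorem incl_eq (j : ℕ) (X) : B.incl j X = B.incl j X * B.c j := by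
  rw [c, ← map_mul, mul_one]

/-- The part of a class outside of the first `N` blocks. -/
def cut (N : ℕ) : VMonoid R →+ VMonoid R :=
  VMonoid.nonUnitalMap (mulCentral (B.d N) (B.d_idem N) (B.d_central N))

/-- The rank of a class in a block. -/
noncomputable def rk (j : ℕ) : VMonoid R →+ ℕ :=
  (VMonoid.rank K (Fin (j + 1))).comp (VMonoid.map (B.proj j))

theorem cut_zero (a : VMonoid R) : B.cut 0 a = a :=
  VMonoid.nonUnitalMap_id (fun r => by change r * B.d 0 = r; simp [d]) a

theorem cut_succ (N : ℕ) (a : VMonoid R) :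
    B.cut N a = B.cut (N + 1) a +
      VMonoid.nonUnitalMap (B.incl N) (VMonoid.map (B.proj N) a) := by
  rw [VMonoid.map_eq_nonUnitalMap, VMonoid.nonUnitalMap_nonUnitalMap]
  refine VMonoid.nonUnitalMap_add (fun r => ?_) (fun r s => ?_) (fun r s => ?_) a
  · change r * B.d N = r * B.d (N + 1) + B.incl N (B.proj N r)
    rw [B.incl_proj, d_succ, mul_add, c]
  · change r * B.d (N + 1) * B.incl N (B.proj N s) = 0
    rw [mul_assoc, B.incl_eq, ← (B.c_central N _).eq, ← mul_assoc (B.d _), d_mul_c,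
      if_pos N.lt_succ_self, zero_mul, mul_zero]
  · change B.incl N (B.proj N r) * (s * B.d (N + 1)) = 0
    rw [B.incl_eq, mul_assoc, ← (B.d_central _ s).eq, ← mul_assoc (B.c N),
      ← (B.d_central _ (B.c N)).eq, d_mul_c, if_pos N.lt_succ_self, zero_mul, mul_zero]

theorem map_proj_eq {a b : VMonoid R} {j : ℕ} (h : B.rk j a = B.rk j b) :
    VMonoid.map (B.proj j) a = VMonoid.map (B.proj j) b :=
  VMonoid.rank_injective h

/-- Blocks are put back one at a time by `cut_succ`; the component in a block is determined by its
rank. -/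
theorem eq_of_cut_eq {a b : VMonoid R} {N : ℕ} (hr : ∀ j < N, B.rk j a = B.rk j b)
    (hc : B.cut N a = B.cut N b) : a = b := by
  induction N with
  | zero => rwa [cut_zero, cut_zero] at hc
  | succ N ih =>
    refine ih (fun j hj => hr j (by omega)) ?_
    rw [B.cut_succ N a, B.cut_succ N b, hc, B.map_proj_eq (hr N N.lt_succ_self)]

theorem rk_unit (j : ℕ) : B.rk j (VMonoid.unit R) = j + 1 := by
  have h : VMonoid.map (B.proj j) (VMonoid.unit R) = VMonoid.unit _ := by
    refine congrArg VMonoid.mk ?_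
    simp only [IdemMat.map, IdemMat.ofElem]
    congr 1
    ext
    simp
  rw [rk, AddMonoidHom.comp_apply, h, VMonoid.rank_unit, Fintype.card_fin]

theorem mul_d_eventually {s : R} (hs : s ∈ I) : ∃ N, ∀ N', N ≤ N' → s * B.d N' = 0 := by
  obtain ⟨N, h⟩ := B.eventually_eq hs
  refine ⟨N, fun N' hN' => ?_⟩
  rw [d, mul_sub, mul_one]
  exact sub_eq_zero.2 (h N' hN').symm

theorem matrix_mul_d_eventually {ι κ : Type*} [Fintype ι] [Fintype κ] {A : Matrix ι κ R}
    (hA : ∀ i j, A i j ∈ I) : ∃ N, ∀ N', N ≤ N' → ∀ i j, A i j * B.d N' = 0 := by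
  choose N hN using fun i j => B.mul_d_eventually (hA i j)
  -- The sum of the thresholds of all entries bounds each of them.
  refine ⟨∑ i, ∑ j, N i j, fun N' h i j => hN i j N' (le_trans ?_ h)⟩
  exact (Finset.single_le_sum (f := fun j => N i j) (fun _ _ => Nat.zero_le _)
    (Finset.mem_univ j)).trans (Finset.single_le_sum (f := fun i => ∑ j, N i j)
    (fun _ _ => Nat.zero_le _) (Finset.mem_univ i))

theorem cut_eventually_eq_zero {a : VMonoid R} (ha : a ∈ VMonoid.ofIdeal I) :
    ∃ N, ∀ N', N ≤ N' → B.cut N' a = 0 := by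
  obtain ⟨e, he, rfl⟩ := ha
  obtain ⟨N, hN⟩ := B.matrix_mul_d_eventually he
  exact ⟨N, fun N' h => VMonoid.nonUnitalMap_eq_zero (hN N' h)⟩

theorem eq_of_rk_eq {a b : VMonoid R} (ha : a ∈ VMonoid.ofIdeal I) (hb : b ∈ VMonoid.ofIdeal I)
    (h : ∀ j, B.rk j a = B.rk j b) : a = b := by
  obtain ⟨N, hN⟩ := B.cut_eventually_eq_zero ha
  obtain ⟨N', hN'⟩ := B.cut_eventually_eq_zero hb
  refine B.eq_of_cut_eq (N := max N N') (fun j _ => h j) ?_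
  rw [hN _ (le_max_left _ _), hN' _ (le_max_right _ _)]

/-- Lift the matrices of an equivalence modulo `I` entrywise to `R`. The errors in the two equations
have entries in `I`, so a late central idempotent `d N` annihilates them, and multiplying by it
makes the equivalence exact. -/
theorem cut_eventually_eq [I.IsTwoSided] {a b : VMonoid R}
    (h : VMonoid.map (Ideal.Quotient.mk I) a = VMonoid.map (Ideal.Quotient.mk I) b) :
    ∃ N, B.cut N a = B.cut N b := by
  induction a using Quotient.inductionOn with | h e
  induction b using Quotient.inductionOn with | h f
  obtain ⟨u, v, huv, hvu⟩ : MatEquiv (e.mat.map (Ideal.Quotient.mk I))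
    (f.mat.map (Ideal.Quotient.mk I)) := Quotient.exact h
  have lift : ∀ {m n : ℕ} (w : Matrix (Fin m) (Fin n) (R ⧸ I)),
      ∃ w' : Matrix (Fin m) (Fin n) R, w'.map (Ideal.Quotient.mk I) = w := fun w =>
    ⟨Matrix.of fun i j => (Ideal.Quotient.mk_surjective (w i j)).choose,
      Matrix.ext fun i j => (Ideal.Quotient.mk_surjective (w i j)).choose_spec⟩
  obtain ⟨u, rfl⟩ := lift u
  obtain ⟨v, rfl⟩ := lift v
  rw [← Matrix.map_mul] at huv hvu
  have h₁ : ∀ i j, (u * v - e.mat) i j ∈ I := fun i j =>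
    Ideal.Quotient.eq.1 (congrFun (congrFun huv i) j)
  have h₂ : ∀ i j, (v * u - f.mat) i j ∈ I := fun i j =>
    Ideal.Quotient.eq.1 (congrFun (congrFun hvu i) j)
  obtain ⟨N₁, hN₁⟩ := B.matrix_mul_d_eventually h₁
  obtain ⟨N₂, hN₂⟩ := B.matrix_mul_d_eventually h₂
  refine ⟨max N₁ N₂, Quotient.sound ?_⟩
  let θ := mulCentral (B.d (max N₁ N₂)) (B.d_idem _) (B.d_central _)
  have hθ : ∀ r, θ r = r * B.d (max N₁ N₂) := fun _ => rfl
  refine ⟨u.map θ, v.map θ, ?_, ?_⟩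
  · change u.map θ * v.map θ = e.mat.map θ
    rw [← Matrix.map_mul]
    ext i j
    have := hN₁ _ (le_max_left N₁ N₂) i j
    rw [Matrix.sub_apply, sub_mul, sub_eq_zero] at this
    exact this
  · change v.map θ * u.map θ = f.mat.map θ
    rw [← Matrix.map_mul]
    ext i j
    have := hN₂ _ (le_max_right N₁ N₂) i j
    rw [Matrix.sub_apply, sub_mul, sub_eq_zero] at this
    exact this

/-- The atom is a rank-one class of `M_{i+1}(K)` carried into `R` by the inclusion of the block. -/
theorem exists_atom (i : ℕ) : ∃ g ∈ VMonoid.ofIdeal I,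
    (∀ j, B.rk j g = if i = j then 1 else 0) ∧ ∀ N, i < N → B.cut N g = 0 := by
  obtain ⟨a, ha⟩ := VMonoid.exists_rank_eq_one (K := K) (n := Fin (i + 1))
  refine ⟨VMonoid.nonUnitalMap (B.incl i) a, ?_, fun j => ?_, fun N hN => ?_⟩
  · induction a using Quotient.inductionOn with | h e
    exact ⟨e.nonUnitalMap (B.incl i), fun _ _ => B.incl_mem _ _, rfl⟩
  · rw [rk, AddMonoidHom.comp_apply, VMonoid.map_eq_nonUnitalMap,
      VMonoid.nonUnitalMap_nonUnitalMap]
    split_ifs with h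
    · subst h
      rw [VMonoid.nonUnitalMap_id (fun X => B.proj_incl i X), ha]
    · rw [VMonoid.nonUnitalMap_of_forall_eq_zero, map_zero]
      intro X
      change B.proj j (B.incl i X) = 0
      -- The projection to block `j` is unchanged by a factor `c j`, which is orthogonal to `c i`.
      rw [← B.proj_incl j (B.proj j _), B.incl_proj, B.incl_eq, mul_assoc]
      change B.proj j (B.incl i X * (B.c i * B.c j)) = 0
      rw [B.c_mul_c h, mul_zero, map_zero]
  · rw [cut, VMonoid.nonUnitalMap_nonUnitalMap]
    refine VMonoid.nonUnitalMap_of_forall_eq_zero (fun X => ?_) a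
    change B.incl i X * B.d N = 0
    rw [B.incl_eq, mul_assoc, ← (B.d_central _ _).eq, d_mul_c, if_pos hN, mul_zero]

end BlockIdeal

/-! ### The block structure of the socle -/

namespace matrixSum

variable {K : Type*} [Field K]

/-- The inclusion of a factor in `⨁ M_i(K)`. -/
def single (j : ℕ) : Matrix (Fin (j + 1)) (Fin (j + 1)) K →ₙ+* matrixSum K where
  toFun X := ⟨(Pi.single j X : (i : ℕ) → Matrix (Fin (i + 1)) (Fin (i + 1)) K),
    (Set.finite_singleton j).subset fun i hi => by
      by_contra h
      exact hi (by rw [Pi.single_eq_of_ne h])⟩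
  map_zero' := Subtype.ext (Pi.single_zero j)
  map_add' X Y := Subtype.ext
    (Pi.single_add (f := fun i => Matrix (Fin (i + 1)) (Fin (i + 1)) K) j X Y)
  map_mul' X Y := Subtype.ext
    (Pi.single_mul (α := fun i => Matrix (Fin (i + 1)) (Fin (i + 1)) K) j X Y)

theorem coe_single (j : ℕ) (X : Matrix (Fin (j + 1)) (Fin (j + 1)) K) :
    (single j X : (i : ℕ) → Matrix (Fin (i + 1)) (Fin (i + 1)) K) = Pi.single j X := rfl

theorem mul_single_one (f : matrixSum K) (j : ℕ) : f * single j 1 = single j (f.1 j) := by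
  refine Subtype.ext (funext fun i => ?_)
  change f.1 i * (Pi.single j 1 : (i : ℕ) → Matrix (Fin (i + 1)) (Fin (i + 1)) K) i =
    (Pi.single j (f.1 j) : (i : ℕ) → Matrix (Fin (i + 1)) (Fin (i + 1)) K) i
  rcases eq_or_ne i j with rfl | h
  · rw [Pi.single_eq_same, Pi.single_eq_same, mul_one]
  · rw [Pi.single_eq_of_ne h, Pi.single_eq_of_ne h, mul_zero]

theorem single_one_mul (f : matrixSum K) (j : ℕ) : single j 1 * f = single j (f.1 j) := by
  refine Subtype.ext (funext fun i => ?_)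
  change (Pi.single j 1 : (i : ℕ) → Matrix (Fin (i + 1)) (Fin (i + 1)) K) i * f.1 i =
    (Pi.single j (f.1 j) : (i : ℕ) → Matrix (Fin (i + 1)) (Fin (i + 1)) K) i
  rcases eq_or_ne i j with rfl | h
  · rw [Pi.single_eq_same, Pi.single_eq_same, one_mul]
  · rw [Pi.single_eq_of_ne h, Pi.single_eq_of_ne h, zero_mul]

theorem exists_sum_single (f : matrixSum K) :
    ∃ N, ∀ N', N ≤ N' → ∑ j ∈ Finset.range N', single j (f.1 j) = f := by
  obtain ⟨N, hN⟩ := f.2.bddAbove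
  refine ⟨N + 1, fun N' h => Subtype.ext (funext fun i => ?_)⟩
  rw [AddSubmonoidClass.coe_finsetSum, Finset.sum_apply, Finset.sum_eq_single i]
  · rw [coe_single, Pi.single_eq_same]
  · intro j _ hj
    rw [coe_single, Pi.single_eq_of_ne hj.symm]
  · intro hi
    rw [coe_single, Pi.single_eq_same]
    by_contra h0
    have := hN h0
    rw [Finset.mem_range] at hi
    omega

end matrixSum

section

variable {K R : Type*} [Field K] [Ring R] [Algebra K R]

theorem single_mul_mem_socle (e : socleAlg K R ≃+* matrixSum K) (j : ℕ) (r : R) :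
    r * (e.symm (matrixSum.single j 1) : socleAlg K R) ∈ socle R :=
  (socle R).mul_mem_left r (e.symm _).2

/-- The unit `c` of a block is central in the socle. As `c r` and `r c` lie in that two-sided ideal,
`c r = c (c r) = c r c = (r c) c = r c`. -/
theorem commute_symm_single_one (e : socleAlg K R ≃+* matrixSum K) (j : ℕ) (r : R) :
    Commute ((e.symm (matrixSum.single j 1) : socleAlg K R) : R) r := by
  set c : socleAlg K R := e.symm (matrixSum.single j 1) with hc
  have hcc : c * c = c := by rw [hc, ← map_mul, ← map_mul, mul_one]
  have hcomm : ∀ s : socleAlg K R, c * s = s * c := fun s => e.injective <| by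
    rw [map_mul, map_mul, hc, e.apply_symm_apply, matrixSum.mul_single_one,
      matrixSum.single_one_mul]
  have hcc' : (c : R) * c = c := congrArg Subtype.val hcc
  have h₁ : (c : R) * (c * r) = c * r * c :=
    congrArg Subtype.val (hcomm ⟨c * r, (socle R).mul_mem_right r c.2⟩)
  have h₂ : (c : R) * (r * c) = r * c * c :=
    congrArg Subtype.val (hcomm ⟨r * c, (socle R).mul_mem_left r c.2⟩)
  calc (c : R) * r = c * (c * r) := by rw [← mul_assoc, hcc']
    _ = c * (r * c) := by rw [h₁, mul_assoc]
    _ = r * c := by rw [h₂, mul_assoc, hcc']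

/-- The block decomposition of a socle isomorphic to `⨁ M_i(K)`. -/
noncomputable def BlockIdeal.ofSocle (e : socleAlg K R ≃+* matrixSum K) :
    BlockIdeal K (socle R) := by
  let c (j : ℕ) : R := (e.symm (matrixSum.single j 1) : socleAlg K R)
  let incl (j : ℕ) : Matrix (Fin (j + 1)) (Fin (j + 1)) K →ₙ+* R :=
    { toFun := fun X => (e.symm (matrixSum.single j X) : socleAlg K R)
      map_zero' := by simp
      map_add' := by simp
      map_mul' := by simp }
  let cut (j : ℕ) (r : R) : socleAlg K R := ⟨r * c j, single_mul_mem_socle e j r⟩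
  let p (j : ℕ) (r : R) : Matrix (Fin (j + 1)) (Fin (j + 1)) K := (e (cut j r)).1 j
  have hc (j : ℕ) (r : R) : Commute (c j) r := commute_symm_single_one e j r
  have hcc (j : ℕ) : c j * c j = c j := by
    change incl j 1 * incl j 1 = incl j 1
    rw [← map_mul, mul_one]
  have hsc (s : socleAlg K R) (j : ℕ) : (s : R) * c j = incl j ((e s).1 j) := by
    have : s * e.symm (matrixSum.single j 1) = e.symm (matrixSum.single j ((e s).1 j)) := by
      rw [RingEquiv.eq_symm_apply, map_mul, e.apply_symm_apply, matrixSum.mul_single_one]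
    exact congrArg Subtype.val this
  have hip (j : ℕ) (r : R) : incl j (p j r) = r * c j := by
    rw [← hsc]
    change r * c j * c j = r * c j
    rw [mul_assoc, hcc]
  -- With this, the ring homomorphism laws for `p j` can be checked after inclusion, where `p j`
  -- becomes multiplication by the central idempotent `c j`.
  have hinj (j : ℕ) : Function.Injective (incl j) := by
    intro X Y h
    have h' := e.symm.injective (Subtype.ext h)
    exact Pi.single_injective (M := fun i => Matrix (Fin (i + 1)) (Fin (i + 1)) K) j
      (congrArg Subtype.val h')
  have hX (j : ℕ) (X) : incl j X * c j = incl j X := by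
    change incl j X * incl j 1 = incl j X
    rw [← map_mul, mul_one]
  exact
    { proj := fun j =>
        { toFun := p j
          map_zero' := hinj j (by rw [hip, zero_mul, map_zero])
          map_one' := hinj j ((hip j 1).trans (one_mul _))
          map_add' := fun r s => hinj j (by rw [map_add, hip, hip, hip, add_mul])
          map_mul' := fun r s => hinj j (by
            rw [map_mul, hip, hip, hip, mul_assoc, mul_assoc, ← mul_assoc (c j), (hc j s).eq,
              mul_assoc, hcc]) }
      incl := incl
      proj_incl := fun j X => hinj j ((hip j _).trans (hX j X))
      incl_proj := hip
      central := hc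
      orthogonal := fun {i j} h => by
        have : incl i 1 * incl j 1 = incl j ((e (e.symm (matrixSum.single i 1))).1 j) :=
          hsc (e.symm (matrixSum.single i 1)) j
        rw [this, e.apply_symm_apply, matrixSum.coe_single, Pi.single_eq_of_ne h.symm, map_zero]
      incl_mem := fun j X => (e.symm _).2
      eventually_eq := fun {s} hs => by
        obtain ⟨N, hN⟩ := matrixSum.exists_sum_single (e ⟨s, hs⟩)
        refine ⟨N, fun N' h => ?_⟩
        have h1 := congrArg Subtype.val (congrArg e.symm (hN N' h))
        rw [map_sum, e.symm_apply_apply, AddSubmonoidClass.coe_finsetSum] at h1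
        rw [Finset.mul_sum]
        exact (Finset.sum_congr rfl fun j _ => hsc ⟨s, hs⟩ j).trans h1 }

end

/-! ### Comparison of ranks with multiplicities, and bijectivity of `τ` -/

section

open MonM Gen

variable {K R : Type*} [Field K] [Ring R] {I : Ideal R} (B : BlockIdeal K I)

/-- Pull the rank-one class of block `j` back to the pedestal and split off some `a i`. Ranks detect
zero on the pedestal, so `a i` uses up the only available rank and nothing else remains. -/
theorem exists_rk_map_a {τ : MonM →+ VMonoid R}
    (hped : Set.BijOn τ (CMon.ped MonM) (VMonoid.ofIdeal I)) (j : ℕ) :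
    ∃ i, ∀ k, B.rk k (τ (of (a i))) = if j = k then 1 else 0 := by
  obtain ⟨g, hg, hgk, -⟩ := B.exists_atom j
  obtain ⟨m, hm, rfl⟩ := hped.surjOn hg
  have hpos : ∀ m ∈ CMon.ped MonM, (∀ k, B.rk k (τ m) = 0) → m = 0 := fun m hm h =>
    hped.injOn hm (zero_mem _) <| B.eq_of_rk_eq (hped.mapsTo hm) (hped.mapsTo (zero_mem _))
      fun k => by rw [h, map_zero, map_zero]
  rcases mem_ped_cases hm with rfl | ⟨i, m', hm', rfl⟩
  · have := hgk j
    simp at this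
  · refine ⟨i, ?_⟩
    have hadd : ∀ k, B.rk k (τ (of (a i))) + B.rk k (τ m') = if j = k then 1 else 0 :=
      fun k => by rw [← map_add, ← map_add, hgk]
    suffices h : m' = 0 by
      subst h
      rwa [add_zero] at hgk
    refine hpos m' hm' fun k => ?_
    have hk := hadd k
    by_cases hjk : j = k
    · subst hjk
      rw [if_pos rfl] at hk
      by_contra h
      refine of_ne_zero (a i) (hpos _ (of_a_mem_ped i) fun k => ?_)
      have := hadd k
      by_cases hjk : j = k
      · subst hjk
        omega
      · rw [if_neg hjk] at this
        omega
    · rw [if_neg hjk] at hk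
      omega

/-- The size of a block fixes which atom it receives: an injection `π` of `ℕ` with `π j ≤ j` is the
identity. -/
theorem rk_map_a {τ : MonM →+ VMonoid R} (hunit : τ u = VMonoid.unit R)
    (hped : Set.BijOn τ (CMon.ped MonM) (VMonoid.ofIdeal I)) (i j : ℕ) :
    B.rk j (τ (of (a i))) = if i = j then 1 else 0 := by
  choose π hπ using exists_rk_map_a B hped
  -- `u` contains `π j + 1` copies of `a (π j)`, each of rank one in block `j`, where `1` has rank
  -- only `j + 1`.
  have hle : ∀ j, π j ≤ j := fun j => by
    have := succ_mul_map_le ((B.rk j).comp τ) (π j)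
    rw [AddMonoidHom.comp_apply, AddMonoidHom.comp_apply, hπ, hunit, B.rk_unit, if_pos rfl] at this
    omega
  have hinj : Function.Injective π := fun j k h => by
    have h1 := hπ j j
    rw [h, hπ] at h1
    by_contra hne
    rw [if_neg (Ne.symm hne), if_pos rfl] at h1
    exact zero_ne_one h1
  have hid : ∀ j, π j = j := fun j => by
    induction j using Nat.strong_induction_on with
    | _ j ih =>
      rcases (hle j).lt_or_eq with h | h
      · exact absurd (hinj (ih _ h)) h.ne
      · exact h
  rw [← hπ i j, hid]

theorem rk_map {τ : MonM →+ VMonoid R} (hunit : τ u = VMonoid.unit R)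
    (hped : Set.BijOn τ (CMon.ped MonM) (VMonoid.ofIdeal I)) (m : MonM) (j : ℕ) :
    B.rk j (τ m) = mult j m := by
  have : (B.rk j).comp τ = mult j :=
    eq_mult (fun i => rk_map_a B hunit hped i j)
      (by rw [AddMonoidHom.comp_apply, hunit, B.rk_unit])
  rw [← this, AddMonoidHom.comp_apply]

/-- Equality of ranks identifies `τ (a i)` with the atom of block `i`, which has no part outside the
first `N` blocks. -/
theorem cut_map_a {τ : MonM →+ VMonoid R} (hunit : τ u = VMonoid.unit R)
    (hped : Set.BijOn τ (CMon.ped MonM) (VMonoid.ofIdeal I)) {i N : ℕ} (h : i < N) :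
    B.cut N (τ (of (a i))) = 0 := by
  obtain ⟨g, hg, hgk, hgN⟩ := B.exists_atom i
  rw [B.eq_of_rk_eq (hped.mapsTo (of_a_mem_ped i)) hg
    fun k => by rw [hgk, rk_map_a B hunit hped], hgN N h]

theorem eq_zero_of_mem_ped {A : Type*} [AddCommMonoid A] (f : MonM →+ A)
    (hf : ∀ l, f (of (a l)) = 0) {m : MonM} (hm : m ∈ CMon.ped MonM) : f m = 0 := by
  induction hm using AddSubmonoid.closure_induction with
  | mem m h =>
    obtain ⟨l, rfl⟩ := exists_eq_of_isIrred h
    exact hf l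
  | zero => exact map_zero f
  | add m m' _ _ h h' => rw [map_add, h, h', add_zero]

theorem eq_of_toQuot_eq {A : Type*} [AddCommMonoid A] (f : MonM →+ A)
    (hf : ∀ l, f (of (a l)) = 0) {m m' : MonM}
    (h : CMon.toQuot (CMon.ped MonM) m = CMon.toQuot (CMon.ped MonM) m') : f m = f m' := by
  obtain ⟨p, hp, q, hq, hpq⟩ := (AddCon.eq _).1 h
  have := congrArg f hpq
  rwa [map_add, map_add, eq_zero_of_mem_ped f hf hp, eq_zero_of_mem_ped f hf hq, add_zero,
    add_zero] at this

theorem bijective_of_blockIdeal {K R : Type*} [Field K] [Ring R] {I : Ideal R} [I.IsTwoSided]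
    (B : BlockIdeal K I) {τ : MonM →+ VMonoid R}
    (hunit : τ u = VMonoid.unit R)
    (hped : Set.BijOn τ (CMon.ped MonM) (VMonoid.ofIdeal I))
    {τbar : CMon.QuotMonoid MonM (CMon.ped MonM) →+ VMonoid (R ⧸ I)}
    (hτbar : ∀ m : MonM, τbar (CMon.toQuot (CMon.ped MonM) m) =
      VMonoid.map (Ideal.Quotient.mk I) (τ m))
    (hbar : Function.Bijective τbar) : Function.Bijective τ := by
  have hrk := rk_map B hunit hped
  constructor
  · intro m m' h
    have hq : CMon.toQuot (CMon.ped MonM) m = CMon.toQuot (CMon.ped MonM) m' :=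
      hbar.injective (by rw [hτbar, hτbar, h])
    exact ext_of_invariants (eq_of_toQuot_eq xCount xCount_a hq)
      (eq_of_toQuot_eq weight weight_a hq) (eq_of_toQuot_eq yCount yCount_a hq)
      fun j => by rw [← hrk, ← hrk, h]
  · intro α
    obtain ⟨q, hq⟩ := hbar.surjective (VMonoid.map (Ideal.Quotient.mk I) α)
    obtain ⟨m, rfl⟩ : ∃ m, CMon.toQuot (CMon.ped MonM) m = q := AddCon.mk'_surjective q
    rw [hτbar] at hq
    obtain ⟨N, hN⟩ := B.cut_eventually_eq hq
    obtain ⟨m', hm'⟩ := exists_eq_add_sum m N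
    have hmult : ∀ j < N, mult j m' = 0 := fun j hj => by
      have := congrArg (mult j) hm'
      simp [Finset.sum_ite_eq', hj] at this
      exact this
    -- Coefficients of the `a i` with `i < N` are invisible outside the first `N` blocks, hence can
    -- be chosen freely.
    have hcut : ∀ c : ℕ → ℕ,
        B.cut N (τ (m' + ∑ i ∈ Finset.range N, c i • of (a i))) = B.cut N (τ m') := fun c => by
      rw [map_add, map_add, map_sum, map_sum, Finset.sum_eq_zero, add_zero]
      intro i hi
      rw [map_nsmul, map_nsmul, cut_map_a B hunit hped (Finset.mem_range.1 hi), nsmul_zero]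
    -- As `m'` has multiplicity zero below `N`, these coefficients give exactly the ranks of `α`
    -- there.
    refine ⟨m' + ∑ i ∈ Finset.range N, B.rk i α • of (a i), B.eq_of_cut_eq (fun j hj => ?_)
      (N := N) ?_⟩
    · rw [hrk, map_add, hmult j hj]
      simp [Finset.sum_ite_eq', hj]
    · rw [hcut, ← hN, ← hcut fun i => mult i m]
      exact congrArg (fun x => B.cut N (τ x)) hm'.symm

end

theorem proposition3p5 {K R : Type*} [Field K] [Ring R] [Algebra K R]
    (hexch : IsExchangeRing R)
    (hsoc : ∃ φ : socleAlg K R →ₙₐ[K] matrixSum K, Function.Bijective φ)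
    (hess : IsEssentialIdeal (socle R))
    (τ : MonM →+ VMonoid R)
    (hunit : τ MonM.u = VMonoid.unit R)
    (hped : Set.BijOn τ (CMon.ped MonM) (VMonoid.ofIdeal (socle R)))
    (τbar : CMon.QuotMonoid MonM (CMon.ped MonM) →+ VMonoid (R ⧸ socle R))
    (hτbar : ∀ m : MonM, τbar (CMon.toQuot (CMon.ped MonM) m) =
      VMonoid.map (Ideal.Quotient.mk (socle R)) (τ m))
    (hbar : Function.Bijective τbar) :
    Function.Bijective τ := by
  obtain ⟨φ, hφ⟩ := hsoc
  exact bijective_of_blockIdeal (BlockIdeal.ofSocle (RingEquiv.ofBijective φ hφ)) hunit hped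
    hτbar hbar
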